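/- Let $\Gamma$ be a finite set of colours and let $\varepsilon\notin\Gamma$ be a neutral letter. A (transition-coloured) game consists of a directed graph $(V,E)$, $E\subseteq V\times V$, in which every vertex has an outgoing edge, a partition $V=V_E\uplus V_A$ into vertices of Eve and of Adam, an initial vertex $v_0\in V$, a colouring $\gamma:E\to\Gamma\cup\{\varepsilon\}$ such that no cycle is labelled exclusively with $\varepsilon$, and a set $\mathbb W\subseteq\Gamma^\omega$. It is $\varepsilon$-free if $\gamma(e)\ne\varepsilon$ for all $e\in E$. A play is an infinite path from $v_0$; its output is the word obtained from its sequence of colours by deleting all $\varepsilon$. The play is winning for Eve if its output is an infinite word that belongs to $\mathbb W$, and winning for Adam otherwise. A strategy of Eve associates to each finite path from $v_0$ ending in a vertex $v\in V_E$ an edge leaving $v$; it is winning if every play that adheres to it is winning for Eve, and Eve wins the game if she has a winning strategy. A memory structure $(M,m_0,\mu)$ for the game, with $m_0\in M$ and $\mu:M\times E\to M$, together with a function assigning to each $(v,m)\in V_E\times M$ an edge leaving $v$, gives the strategy that plays this edge in $v$ when $m$ is the memory state reached from $m_0$ by reading with $\mu$ the edges played so far; its size is $|M|$. A family of games is half-positionally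 determined if Eve can win every game of the family that is won by her using a strategy given by a memory structure of size $1$. Let $\mathcal F\subseteq\mathcal P(\Gamma)$ be a Muller condition. An $\mathcal F$-game is a game with $\mathbb W=\{w\in\Gamma^\omega : \mathrm{Inf}(w)\in\mathcal F\}$, where $\mathrm{Inf}(w)$ is the set of letters occurring infinitely often in $w$. Let $\mathfrak{mem}_{\mathrm{gen}}(\mathcal F)$ (resp. $\mathfrak{mem}_{\mathrm{gen}}^{\varepsilon\text{-free}}(\mathcal F)$) be the least $n\ge 1$ such that Eve can win every $\mathcal F$-game (resp. every $\varepsilon$-free $\mathcal F$-game) that is won by her using a strategy given by a memory structure of size $n$ ($\infty$ if there is no such $n$). Then the family of $\varepsilon$-free $\mathcal F$-games is half-positionally determined if and only if the family of all $\mathcal F$-games (with $\varepsilon$-transitions allowed) is half-positionally determined. That is, $\mathfrak{mem}_{\mathrm{gen}}(\mathcal F)=1$ if and only if $\mathfrak{mem}_{\mathrm{gen}}^{\varepsilon\text{-free}}(\mathcal F)=1$. All this holds both for games over arbitrary, possibly infinite, graphs and, with all notions relativised, for games over finite graphs. -/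

import Mathlib

universe u v

namespace MullerGames

/-- `Inf(w)`: the letters that occur infinitely often in the infinite word `w`. -/
def infLetters {Γ : Type v} (w : ℕ → Γ) : Set Γ :=
  {a | {n | w n = a}.Infinite}

/-- The subset of `Γ^ω` defined by the Muller condition `F`: the infinite words `w` with
`Inf(w) ∈ F`. -/
def mullerLanguage {Γ : Type v} (F : Set (Set Γ)) : Set (ℕ → Γ) :=
  {w | infLetters w ∈ F}

/-- `u` is the infinite word obtained from `w ∈ (Γ ∪ {ε})^ω` by deleting all occurrences of `ε`.
Here `Option Γ` is `Γ ∪ {ε}`, with `none` in the role of `ε`. There is at most one such `u`, and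
there is none exactly when only finitely many letters of `w` differ from `ε`. -/
def IsErasure {Γ : Type v} (w : ℕ → Option Γ) (u : ℕ → Γ) : Prop :=
  ∃ φ : ℕ → ℕ, StrictMono φ ∧ Set.range φ = {n | w n ≠ none} ∧ ∀ n, w (φ n) = some (u n)

/-- A transition-coloured game with colours in `Γ`. The vertices of Eve are those in `eve`, the
vertices of Adam are all others; every vertex has an outgoing edge; no cycle consists exclusively
of `ε`-coloured edges. -/
structure Game (Γ : Type v) where
  V : Type u
  eve : Set V
  edges : Set (V × V)
  init : V
  colour : edges → Option Γ
  win : Set (ℕ → Γ)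
  exists_edge : ∀ x : V, ∃ y : V, (x, y) ∈ edges
  no_eps_cycle : ∀ x : V,
    ¬ Relation.TransGen (fun a b => ∃ h : (a, b) ∈ edges, colour ⟨(a, b), h⟩ = none) x x

namespace Game

variable {Γ : Type v} (G : Game.{u, v} Γ)

/-- The vertex that an edge leaves. -/
def src (e : G.edges) : G.V := e.1.1

/-- The vertex that an edge leads to. -/
def tgt (e : G.edges) : G.V := e.1.2

/-- The finite sequence of edges is a path that starts in the vertex `x`. -/
def IsPathFrom : G.V → List G.edges → Prop
  | _, [] => True
  | x, e :: h => G.src e = x ∧ IsPathFrom (G.tgt e) h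

/-- The vertex in which a finite path from `x` ends. -/
def endFrom : G.V → List G.edges → G.V
  | x, [] => x
  | _, e :: h => endFrom (G.tgt e) h

/-- Partial plays: finite paths from the initial vertex. -/
def IsPartialPlay (h : List G.edges) : Prop := G.IsPathFrom G.init h

/-- The vertex in which a partial play ends. -/
def last (h : List G.edges) : G.V := G.endFrom G.init h

/-- Plays: infinite paths from the initial vertex. -/
def IsPlay (ρ : ℕ → G.edges) : Prop :=
  G.src (ρ 0) = G.init ∧ ∀ n, G.tgt (ρ n) = G.src (ρ (n + 1))

/-- The prefix of length `n` of a sequence of edges. -/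
def pre (ρ : ℕ → G.edges) (n : ℕ) : List G.edges := (List.range n).map ρ

/-- The play is winning for Eve: its output is an infinite word in the winning condition.
Otherwise it is winning for Adam. -/
def IsWinningPlay (ρ : ℕ → G.edges) : Prop :=
  ∃ w : ℕ → Γ, IsErasure (fun n => G.colour (ρ n)) w ∧ w ∈ G.win

/-- Strategies of Eve: to each partial play that ends in a vertex of Eve, an edge leaving that
vertex is associated. The values on all other sequences of edges are irrelevant. -/
def IsStrategy (σ : List G.edges → G.edges) : Prop :=
  ∀ h, G.IsPartialPlay h → G.last h ∈ G.eve → G.src (σ h) = G.last h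

/-- The play `ρ` adheres to the strategy `σ` of Eve. -/
def Adheres (σ : List G.edges → G.edges) (ρ : ℕ → G.edges) : Prop :=
  ∀ n, G.last (G.pre ρ n) ∈ G.eve → ρ n = σ (G.pre ρ n)

/-- `σ` is a winning strategy of Eve. -/
def IsWinningStrategy (σ : List G.edges → G.edges) : Prop :=
  G.IsStrategy σ ∧ ∀ ρ, G.IsPlay ρ → G.Adheres σ ρ → G.IsWinningPlay ρ

/-- Eve wins the game. -/
def EveWins : Prop := ∃ σ, G.IsWinningStrategy σ

/-- Memory structures for the game, with set of states `M`. -/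
structure Memory (M : Type) where
  start : M
  update : M → G.edges → M

variable {G}

/-- The state of the memory after a finite sequence of edges. -/
def Memory.state {M : Type} (μ : G.Memory M) (h : List G.edges) : M :=
  h.foldl μ.update μ.start

/-- The memory structure sets a winning strategy: for some next-move function, the strategy that
plays `next x m` in the vertex `x` when the memory is in the state `m` is winning. -/
def Memory.SetsWinningStrategy {M : Type} (μ : G.Memory M) : Prop :=
  ∃ next : G.eve → M → G.edges, (∀ x m, G.src (next x m) = x) ∧
    ∃ σ, G.IsWinningStrategy σ ∧
      ∀ h, G.IsPartialPlay h → ∀ hx : G.last h ∈ G.eve, σ h = next ⟨G.last h, hx⟩ (μ.state h)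

variable (G)

/-- Eve can win the game with a strategy given by a memory structure with `n` states. -/
def EveWinsWithMemory (n : ℕ) : Prop :=
  ∃ (M : Type) (_ : Fintype M) (μ : G.Memory M), Fintype.card M = n ∧ μ.SetsWinningStrategy

/-- The game has no `ε`-transitions. -/
def EpsFree : Prop := ∀ e, G.colour e ≠ none

end Game

/-- Half-positional determinacy of a family of games. -/
def HalfPositionallyDetermined {Γ : Type v} (𝒢 : Set (Game.{u, v} Γ)) : Prop :=
  ∀ G ∈ 𝒢, G.EveWins → G.EveWinsWithMemory 1

/-- The general memory requirements of a family of games: the least number `n ≥ 1` such that every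
game of the family that is won by Eve can be won by her with a memory of size `n`
(`⊤` if there is no such number). -/
noncomputable def memGen {Γ : Type v} (𝒢 : Set (Game.{u, v} Γ)) : ℕ∞ :=
  sInf {k | ∃ n : ℕ, k = n ∧ 1 ≤ n ∧ ∀ G ∈ 𝒢, G.EveWins → G.EveWinsWithMemory n}

/-- The `F`-games, over arbitrary graphs and possibly with `ε`-transitions. -/
def games {Γ : Type v} (F : Set (Set Γ)) : Set (Game.{u, v} Γ) :=
  {G | G.win = mullerLanguage F}

/-- The `ε`-free `F`-games. -/
def epsFreeGames {Γ : Type v} (F : Set (Set Γ)) : Set (Game.{u, v} Γ) :=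
  {G | G ∈ games F ∧ G.EpsFree}

/-- The games with finitely many vertices. -/
def finiteGames (Γ : Type v) : Set (Game.{u, v} Γ) :=
  {G | Finite G.V}

end MullerGames

/-!
Call a set of colours losing if it is empty or not in `F`; a play is won by Eve exactly if the set
of its recurring colours is not losing, so `ε` needs no special treatment. All the families of games
in question are half-positionally determined if and only if the union of two losing sets is losing
(`halfPositionallyDetermined_iff`), a criterion which mentions neither `ε` nor finiteness.

If losing sets `A` and `B` have a union that is not losing, glue a loop that reads `A` and a loop
that reads `B` at a common vertex of Eve. In this finite `ε`-free game she wins by alternating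
between the loops, but not without memory (`losingUnionClosed_of_halfPositionallyDetermined`).

Conversely, let losing sets be closed under unions, and take the tree of partial plays consistent
with a winning strategy. The nodes can be compared by a total well-founded relation, and the tree
can be extended to a labelled graph in which sources may be raised and targets lowered, such that
still all infinite paths are won (`hasMonotoneExtension`). If Eve plays in each vertex as after the
least consistent partial play leading there, her plays are labelled as infinite paths of the
extension (`Game.eveWinsWithMemory_one`), so they are won.

The extension is found by induction on the set `C` of colours. Without colours all edges are
`ε`-edges, hence well-founded, and the rank serves. If `C` is not losing, it has a largest losing
subset `D`; the `D`-coloured part is extended inductively, and all edges with colours in `C \ D` are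
added. If `C` is losing and nonempty, the vertices fall into levels indexed by ordinals, no edge goes
up, and inside each level a colour of `C` is missing (`exists_levels`); an infinite path eventually
stays in one level, so that the comparison by levels first and inductively inside a level works.
-/

namespace MullerGames

/-! ### Labelled graphs all of whose runs are won -/

section Graphs

variable {Γ : Type v} {T : Type u}

/-- The colours that occur infinitely often in `w`, where `none` stands for `ε` and is ignored. -/
def recurring (w : ℕ → Option Γ) : Set Γ :=
  {a | {n | w n = some a}.Infinite}

lemma recurring_shift (w : ℕ → Option Γ) (k : ℕ) :
    recurring (fun n => w (n + k)) = recurring w := by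
  ext a
  change {n | w (n + k) = some a}.Infinite ↔ {n | w n = some a}.Infinite
  rw [← Nat.frequently_atTop_iff_infinite, ← Nat.frequently_atTop_iff_infinite]
  conv_rhs => rw [← Filter.map_add_atTop_eq_nat k, Filter.frequently_map]

/-- The word `w` is read along the infinite path `x` of the labelled graph `R`. -/
def IsRun (R : T → Option Γ → T → Prop) (x : ℕ → T) (w : ℕ → Option Γ) : Prop :=
  ∀ n, R (x n) (w n) (x (n + 1))

lemma IsRun.shift {R : T → Option Γ → T → Prop} {x : ℕ → T} {w : ℕ → Option Γ}
    (h : IsRun R x w) (k : ℕ) : IsRun R (fun n => x (n + k)) (fun n => w (n + k)) := by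
  intro n
  have := h (n + k)
  rwa [show n + k + 1 = n + 1 + k by omega] at this

/-- No infinite path of `R` has its set of recurring colours in `L`. -/
def Avoids (L : Set (Set Γ)) (R : T → Option Γ → T → Prop) : Prop :=
  ∀ x w, IsRun R x w → recurring w ∉ L

/-- The edges of `R` are labelled with `ε` or with colours in `C`. -/
def Uses (C : Set Γ) (R : T → Option Γ → T → Prop) : Prop :=
  ∀ u c v, R u (some c) v → c ∈ C

lemma Avoids.mono {L : Set (Set Γ)} {R S : T → Option Γ → T → Prop} (h : Avoids L R)
    (hSR : ∀ u c v, S u c v → R u c v) : Avoids L S :=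
  fun x w hx => h x w fun n => hSR _ _ _ (hx n)

lemma recurring_subset {C : Set Γ} {R : T → Option Γ → T → Prop} (hC : Uses C R)
    {x : ℕ → T} {w : ℕ → Option Γ} (h : IsRun R x w) : recurring w ⊆ C := by
  intro a ha
  obtain ⟨n, hn⟩ := Set.Infinite.nonempty ha
  exact hC _ _ _ ((show w n = some a from hn) ▸ h n)

/-- The labelled graph `R` extends to a labelled graph `S`, still without infinite paths whose set
of recurring colours is in `L`, that is monotone for a well-founded total comparison `le`: an edge
of `S` persists if its source is raised and its target is lowered. Totality and well-foundedness
are expressed together by the existence of least elements; transitivity is not needed. -/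
def HasMonotoneExtension (L : Set (Set Γ)) (C : Set Γ) (R : T → Option Γ → T → Prop) : Prop :=
  ∃ (le : T → T → Prop) (S : T → Option Γ → T → Prop),
    (∀ X : Set T, X.Nonempty → ∃ m ∈ X, ∀ y ∈ X, le m y) ∧
    (∀ u c v, R u c v → S u c v) ∧ Uses C S ∧ Avoids L S ∧
    ∀ u u' c v v', le u' u → S u' c v' → le v v' → S u c v

/-- Without colours, an infinite path is lost, so that the edges are well-founded and can be
compared through their rank. -/
lemma hasMonotoneExtension_empty {L : Set (Set Γ)} (h0 : ∅ ∈ L)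
    {R : T → Option Γ → T → Prop} (hC : Uses ∅ R) (hR : Avoids L R) :
    HasMonotoneExtension L ∅ R := by
  have hlabel : ∀ u c v, R u c v → c = none := by
    rintro u (_ | c) v h
    · rfl
    · exact (hC _ _ _ h).elim
  have hwf : IsWellFounded T (fun v u => R u none v) := by
    refine ⟨wellFounded_iff_isEmpty_descending_chain.2 ⟨fun ⟨f, hf⟩ => ?_⟩⟩
    refine hR f (fun _ => none) hf ?_
    have : recurring (fun _ : ℕ => (none : Option Γ)) = ∅ := by
      ext a; simp [recurring]
    rwa [this]
  let rk : T → Ordinal.{u} := IsWellFounded.rank (fun v u => R u none v)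
  refine ⟨fun u v => rk u ≤ rk v, fun u c v => c = none ∧ rk v < rk u, ?_, ?_, ?_, ?_, ?_⟩
  · intro X hX
    obtain ⟨m, hm, h⟩ := (InvImage.wf rk Ordinal.lt_wf).has_min X hX
    exact ⟨m, hm, fun y hy => not_lt.1 (h y hy)⟩
  · intro u c v h
    have hc := hlabel _ _ _ h
    subst hc
    exact ⟨rfl, IsWellFounded.rank_lt_of_rel (r := fun v u => R u none v) h⟩
  · rintro u c v ⟨h, -⟩
    cases h
  · intro x w hx _
    exact (wellFounded_iff_isEmpty_descending_chain.1 Ordinal.lt_wf).false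
      ⟨fun n => rk (x n), fun n => (hx n).2⟩
  · rintro u u' c v v' h ⟨hc, h1⟩ h'
    exact ⟨hc, (h'.trans_lt h1).trans_le h⟩

/-- If `C ∉ L`, the subsets of `C` in `L` have a largest element `D`, and infinitely many colours
in `C \ D` suffice to avoid `L`. So all edges with these colours can be added. -/
lemma hasMonotoneExtension_of_notMem [Finite Γ] {L : Set (Set Γ)} (h0 : ∅ ∈ L)
    (hU : ∀ A ∈ L, ∀ B ∈ L, A ∪ B ∈ L) {C : Set Γ} (hCL : C ∉ L)
    (ih : ∀ D < C, ∀ R : T → Option Γ → T → Prop, Uses D R → Avoids L R →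
      HasMonotoneExtension L D R)
    {R : T → Option Γ → T → Prop} (hC : Uses C R) (hR : Avoids L R) :
    HasMonotoneExtension L C R := by
  obtain ⟨D, ⟨hDL, hDC⟩, hmax⟩ : ∃ D, (D ∈ L ∧ D ⊆ C) ∧ ∀ A, A ∈ L → A ⊆ C → A ⊆ D := by
    obtain ⟨D, hD⟩ := (Set.toFinite {D | D ∈ L ∧ D ⊆ C}).exists_maximal
      ⟨∅, h0, Set.empty_subset _⟩
    refine ⟨D, hD.prop, fun A hA hAC => ?_⟩
    exact Set.subset_union_left.trans
      (hD.le_of_ge ⟨hU A hA D hD.prop.1, Set.union_subset hAC hD.prop.2⟩ Set.subset_union_right)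
  have hlt : D < C := lt_of_le_of_ne hDC fun h => hCL (h ▸ hDL)
  obtain ⟨le, S, hle, hRS, hSD, hS, hmono⟩ :=
    ih D hlt (fun u c v => R u c v ∧ ∀ a, c = some a → a ∈ D) (fun u c v h => h.2 c rfl)
      (hR.mono fun u c v h => h.1)
  have hUses : Uses C (fun u c v => S u c v ∨ ∃ a ∈ C \ D, c = some a) := by
    rintro u c v (h | ⟨a, ha, h⟩)
    · exact hDC (hSD _ _ _ h)
    · cases h
      exact ha.1
  refine ⟨le, fun u c v => S u c v ∨ ∃ a ∈ C \ D, c = some a, hle, ?_, hUses, ?_, ?_⟩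
  · rintro u (_ | c) v h
    · exact Or.inl (hRS _ _ _ ⟨h, by simp⟩)
    · by_cases hc : c ∈ D
      · exact Or.inl (hRS _ _ _ ⟨h, by simpa using hc⟩)
      · exact Or.inr ⟨c, ⟨hC _ _ _ h, hc⟩, rfl⟩
  · intro x w hx hL
    have hsub : recurring w ⊆ D := hmax _ hL (recurring_subset hUses hx)
    have hfin : {n | ∃ a ∈ C \ D, w n = some a}.Finite := by
      have : {n | ∃ a ∈ C \ D, w n = some a} = ⋃ a ∈ C \ D, {n | w n = some a} := by
        ext n; simp
      rw [this]
      refine (Set.toFinite _).biUnion fun a ha => ?_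
      by_contra h
      exact ha.2 (hsub h)
    obtain ⟨k, hk⟩ := hfin.bddAbove
    refine hS (fun n => x (n + (k + 1))) (fun n => w (n + (k + 1))) (fun n => ?_)
      ((recurring_shift w (k + 1)).symm ▸ hL)
    exact (hx.shift (k + 1) n).resolve_right fun h => by
      have : n + (k + 1) ≤ k := hk h
      omega
  · rintro u u' c v v' h (h1 | h1) h'
    · exact Or.inl (hmono _ _ _ _ _ h h1 h')
    · exact Or.inr h1

/-- In the graph `R`, some path of `n + 1` edges from the given vertex ends with an edge of
colour `a`. -/
def CanSee (R : T → Option Γ → T → Prop) (a : Γ) : ℕ → T → Prop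
  | 0, u => ∃ v, R u (some a) v
  | n + 1, u => ∃ c v, R u c v ∧ CanSee R a n v

/-- If every colour in `C` can be seen from every vertex of `X`, without leaving `X`, then some
infinite path sees all of them infinitely often: it pursues the colours of a sequence in which
each of them recurs, always on a shortest path to the current goal. -/
lemma exists_run_recurring [Finite Γ] {R : T → Option Γ → T → Prop} {C : Set Γ}
    (hne : C.Nonempty) {X : Set T} (hX : X.Nonempty) (hRX : ∀ u c v, R u c v → v ∈ X)
    (hsee : ∀ u ∈ X, ∀ a ∈ C, ∃ n, CanSee R a n u) :
    ∃ x w, IsRun R x w ∧ C ⊆ recurring w := by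
  classical
  have : Nonempty C := hne.to_subtype
  obtain ⟨f, hf⟩ := exists_surjective_nat C
  let g : ℕ → C := fun n => f n.unpair.1
  have hg : ∀ a : C, {n | g n = a}.Infinite := by
    intro a
    obtain ⟨m, rfl⟩ := hf a
    refine Set.infinite_of_injective_forall_mem (f := fun k => Nat.pair m k) ?_ ?_
    · intro k l h
      exact (Nat.pair_eq_pair.1 h).2
    · intro k
      simp [g]
  let d : X × ℕ → ℕ := fun p => Nat.find (hsee p.1 p.1.2 (g p.2) (g p.2).2)
  have hstep : ∀ p : X × ℕ, ∃ (c : Option Γ) (q : X × ℕ), R p.1 c q.1 ∧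
      ((c = some (g p.2 : Γ) ∧ q.2 = p.2 + 1) ∨ (q.2 = p.2 ∧ d q < d p)) := by
    intro p
    have hspec := Nat.find_spec (hsee p.1 p.1.2 (g p.2) (g p.2).2)
    rcases hd : Nat.find (hsee p.1 p.1.2 (g p.2) (g p.2).2) with _ | k
    · rw [hd] at hspec
      obtain ⟨v, hv⟩ := hspec
      exact ⟨_, (⟨v, hRX _ _ _ hv⟩, p.2 + 1), hv, Or.inl ⟨rfl, rfl⟩⟩
    · rw [hd] at hspec
      obtain ⟨c, v, hv, h⟩ := hspec
      refine ⟨c, (⟨v, hRX _ _ _ hv⟩, p.2), hv, Or.inr ⟨rfl, ?_⟩⟩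
      have h1 : d p = k + 1 := hd
      rw [h1]
      exact Nat.lt_succ_of_le (Nat.find_min' _ h)
  choose c q hq hcq using hstep
  obtain ⟨x₀, hx₀⟩ := hX
  let p : ℕ → X × ℕ := fun n => q^[n] (⟨x₀, hx₀⟩, 0)
  have hp : ∀ n, p (n + 1) = q (p n) := fun n => Function.iterate_succ_apply' _ _ _
  -- a goal that is being pursued is reached
  have hreach : ∀ m t, d (p t) = m → ∃ s, (p s).2 = (p t).2 ∧ c (p s) = some (g (p t).2 : Γ) ∧
      (p (s + 1)).2 = (p t).2 + 1 := by
    intro m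
    induction m using Nat.strong_induction_on with
    | _ m ih =>
      intro t ht
      rcases hcq (p t) with ⟨h1, h2⟩ | ⟨h1, h2⟩
      · exact ⟨t, rfl, h1, by rw [hp, h2]⟩
      · rw [← hp] at h1 h2
        obtain ⟨s, hs⟩ := ih _ (ht ▸ h2) (t + 1) rfl
        rw [h1] at hs
        exact ⟨s, hs⟩
  have hgoal : ∀ j, ∃ s, (p s).2 = j ∧ c (p s) = some (g j : Γ) ∧ (p (s + 1)).2 = j + 1 := by
    intro j
    induction j with
    | zero => exact hreach _ 0 rfl
    | succ j ih =>
      obtain ⟨s, -, -, hs⟩ := ih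
      obtain ⟨t, ht⟩ := hreach _ (s + 1) rfl
      rw [hs] at ht
      exact ⟨t, ht⟩
  choose s hs1 hs2 hs3 using hgoal
  refine ⟨fun n => (p n).1, fun n => c (p n), fun n => ?_, fun a ha => ?_⟩
  · change R (p n).1 (c (p n)) (p (n + 1)).1
    rw [hp]
    exact hq (p n)
  · have hinj : Function.Injective s := fun i j h => by rw [← hs1 i, ← hs1 j, h]
    refine ((hg ⟨a, ha⟩).image hinj.injOn).mono ?_
    rintro _ ⟨j, hj, rfl⟩
    have hj' : g j = ⟨a, ha⟩ := hj
    change c (p (s j)) = some a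
    rw [hs2, hj']

/-- If `C ∈ L`, the vertices can be sorted into levels which no edge leaves upwards, such that some
colour of `C` is missing inside each level. A level consists of those vertices among the remaining
ones from which a suitable colour can no longer be seen. -/
lemma exists_levels [Finite Γ] {L : Set (Set Γ)} {C : Set Γ} (hCL : C ∈ L) (hne : C.Nonempty)
    {R : T → Option Γ → T → Prop} (hC : Uses C R) (hR : Avoids L R) :
    ∃ (lev : T → Ordinal.{u}) (a : Ordinal.{u} → Γ), (∀ i, a i ∈ C) ∧
      ∀ u c v, R u c v → lev v ≤ lev u ∧ (lev v = lev u → c ≠ some (a (lev u))) := by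
  let res : Set T → T → Option Γ → T → Prop := fun X u c v => R u c v ∧ u ∈ X ∧ v ∈ X
  have hex : ∀ X : Set T, ∃ a ∈ C, X.Nonempty → ∃ u ∈ X, ∀ n, ¬ CanSee (res X) a n u := by
    intro X
    by_cases hX : X.Nonempty
    · by_contra! hcon
      obtain ⟨x, w, hx, hw⟩ := exists_run_recurring (R := res X) hne hX (fun u c v h => h.2.2)
        (fun u hu a ha => (hcon a ha).2 u hu)
      have hx' : IsRun R x w := fun n => (hx n).1
      exact hR x w hx' ((recurring_subset hC hx').antisymm hw ▸ hCL)
    · obtain ⟨a, ha⟩ := hne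
      exact ⟨a, ha, fun h => (hX h).elim⟩
  choose b hbC hb using hex
  let bot : Set T → Set T := fun X => {u ∈ X | ∀ n, ¬ CanSee (res X) (b X) n u}
  let stage : Ordinal.{u} → Set T := Ordinal.lt_wf.fix fun i f => bot {u | ∀ j hj, u ∉ f j hj}
  let rest : Ordinal.{u} → Set T := fun i => {u | ∀ j < i, u ∉ stage j}
  have hstage : ∀ i, stage i = bot (rest i) := fun i => Ordinal.lt_wf.fix_eq _ i
  have hall : ∀ u, ∃ i, u ∈ stage i := by
    by_contra! hcon
    obtain ⟨u, hu⟩ := hcon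
    have hne' : ∀ i, ∃ v, v ∈ stage i := fun i => by
      obtain ⟨v, hv, h⟩ := hb (rest i) ⟨u, fun j _ => hu j⟩
      exact ⟨v, by rw [hstage]; exact ⟨hv, h⟩⟩
    choose f hf using hne'
    refine not_injective_of_ordinal f fun i j hij => ?_
    have hdis : ∀ i j, i < j → f i ≠ f j := fun i j hlt h => by
      have h1 := hf j
      rw [hstage] at h1
      exact h1.1 i hlt (h ▸ hf i)
    rcases lt_trichotomy i j with h | h | h
    · exact (hdis i j h hij).elim
    · exact h
    · exact (hdis j i h hij.symm).elim
  choose lev hlev using hall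
  have hrest : ∀ u i, i ≤ lev u → u ∈ rest i := by
    intro u i hi j hj hu
    have h1 := hlev u
    rw [hstage] at h1
    exact h1.1 j (hj.trans_le hi) hu
  refine ⟨lev, fun i => b (rest i), fun i => hbC _, fun u c v h => ?_⟩
  have hu := hlev u
  rw [hstage] at hu
  have hle : lev v ≤ lev u := by
    by_contra! hlt
    have hv : v ∈ rest (lev u) := hrest v _ hlt.le
    have : v ∈ stage (lev u) := by
      rw [hstage]
      exact ⟨hv, fun n hn => hu.2 (n + 1) ⟨c, v, ⟨h, hu.1, hv⟩, hn⟩⟩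
    exact hrest v (Order.succ (lev u)) (Order.succ_le_of_lt hlt) _ (Order.lt_succ _) this
  refine ⟨hle, fun heq hc => ?_⟩
  exact hu.2 0 ⟨v, hc ▸ h, hu.1, hrest v _ heq.ge⟩

/-- If `C ∈ L`, the vertices are compared by their levels first and, inside a level, as in the
extension that exists because a colour is missing there. -/
lemma hasMonotoneExtension_of_mem [Finite Γ] {L : Set (Set Γ)} {C : Set Γ} (hCL : C ∈ L)
    (hne : C.Nonempty)
    (ih : ∀ D < C, ∀ R : T → Option Γ → T → Prop, Uses D R → Avoids L R →
      HasMonotoneExtension L D R)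
    {R : T → Option Γ → T → Prop} (hC : Uses C R) (hR : Avoids L R) :
    HasMonotoneExtension L C R := by
  obtain ⟨lev, a, haC, hlev⟩ := exists_levels hCL hne hC hR
  have hext : ∀ i, HasMonotoneExtension L (C \ {a i})
      (fun u c v => R u c v ∧ lev u = i ∧ lev v = i) := by
    intro i
    refine ih _ ⟨Set.sdiff_subset, fun h : C ⊆ C \ {a i} => (h (haC i)).2 rfl⟩ _ ?_ (hR.mono fun u c v h => h.1)
    rintro u c v ⟨h, hu, hv⟩
    exact ⟨hC _ _ _ h, fun hc => (hlev _ _ _ h).2 (hv.trans hu.symm) (by rw [hu, hc])⟩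
  choose le S hle hRS hSC hS hmono using hext
  have hUses : Uses C (fun u c v => (lev v < lev u ∧ ∀ a, c = some a → a ∈ C) ∨
      (lev v = lev u ∧ S (lev u) u c v)) := by
    rintro u c v (⟨-, h⟩ | ⟨-, h⟩)
    · exact h c rfl
    · exact (hSC _ _ _ _ h).1
  refine ⟨fun u v => lev u < lev v ∨ (lev u = lev v ∧ le (lev u) u v), _, ?_, ?_, hUses, ?_, ?_⟩
  · intro X hX
    obtain ⟨m, hm, hmin⟩ := (InvImage.wf lev Ordinal.lt_wf).has_min X hX
    obtain ⟨l, ⟨hl, hl'⟩, hlmin⟩ := hle (lev m) {y ∈ X | lev y = lev m} ⟨m, hm, rfl⟩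
    refine ⟨l, hl, fun y hy => ?_⟩
    have h1 : lev m ≤ lev y := not_lt.1 (hmin y hy)
    rcases h1.lt_or_eq with h | h
    · exact Or.inl (hl' ▸ h)
    · exact Or.inr ⟨hl'.trans h, hl'.symm ▸ hlmin y ⟨hy, h.symm⟩⟩
  · intro u c v h
    obtain ⟨h1, -⟩ := hlev _ _ _ h
    rcases h1.lt_or_eq with h2 | h2
    · exact Or.inl ⟨h2, fun a ha => hC u a v (ha ▸ h)⟩
    · exact Or.inr ⟨h2, hRS _ _ _ _ ⟨h, rfl, h2⟩⟩
  · intro x w hx hL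
    have hanti : Antitone fun n => lev (x n) := antitone_nat_of_succ_le fun n => by
      rcases hx n with ⟨h, -⟩ | ⟨h, -⟩
      · exact h.le
      · exact h.le
    obtain ⟨k, hk⟩ := WellFoundedLT.antitone_chain_condition hanti
    have hk' : ∀ n, k ≤ n → lev (x n) = lev (x k) := fun n hn => (hk n hn).symm
    refine hS (lev (x k)) (fun n => x (n + k)) (fun n => w (n + k)) (fun n => ?_)
      ((recurring_shift w k).symm ▸ hL)
    have h1 := hk' (n + k) (by omega)
    have h2 := hk' (n + 1 + k) (by omega)
    rcases hx.shift k n with ⟨h, -⟩ | ⟨-, h⟩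
    · simp only [h1, h2, lt_irrefl] at h
    · simpa only [h1] using h
  · rintro u u' c v v' h h1 h'
    have hlu : lev u' ≤ lev u := h.elim le_of_lt fun h => h.1.le
    have hlv : lev v ≤ lev v' := h'.elim le_of_lt fun h => h.1.le
    have hlab := fun a (ha : c = some a) => hUses u' a v' (ha ▸ h1)
    rcases h1 with ⟨h1, -⟩ | ⟨h1, h2⟩
    · exact Or.inl ⟨(hlv.trans_lt h1).trans_le hlu, hlab⟩
    · rcases h with h | ⟨h, h3⟩
      · exact Or.inl ⟨(hlv.trans h1.le).trans_lt h, hlab⟩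
      · rcases h' with h' | ⟨h', h4⟩
        · exact Or.inl ⟨(h'.trans_le h1.le).trans_le hlu, hlab⟩
        · refine Or.inr ⟨by rw [h', h1, h], ?_⟩
          rw [h] at h2 h3
          rw [h', h1, h] at h4
          exact hmono _ _ _ _ _ _ h3 h2 h4

/-- A labelled graph whose infinite paths all avoid a family closed under unions has a monotone
extension with the same property. -/
theorem hasMonotoneExtension [Finite Γ] {L : Set (Set Γ)} (h0 : ∅ ∈ L)
    (hU : ∀ A ∈ L, ∀ B ∈ L, A ∪ B ∈ L) (C : Set Γ) :
    ∀ R : T → Option Γ → T → Prop, Uses C R → Avoids L R → HasMonotoneExtension L C R := by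
  induction C using WellFoundedLT.induction with
  | ind C ih =>
    intro R hC hR
    by_cases hCL : C ∈ L
    · rcases C.eq_empty_or_nonempty with rfl | hne
      · exact hasMonotoneExtension_empty h0 hC hR
      · exact hasMonotoneExtension_of_mem hCL hne ih hC hR
    · exact hasMonotoneExtension_of_notMem h0 hU hCL ih hC hR

end Graphs

/-! ### Positional strategies from monotone extensions -/

/-- The sets of colours with which Eve loses if they are the colours recurring in a play. The empty
set belongs to them: an output that is not infinite is lost, whether or not `∅ ∈ F`. -/
def losing {Γ : Type v} (F : Set (Set Γ)) : Set (Set Γ) :=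
  {A | A.Nonempty → A ∉ F}

/-- The union of two nonempty sets outside `F` is outside `F`. -/
def LosingUnionClosed {Γ : Type v} (F : Set (Set Γ)) : Prop :=
  ∀ A ∈ losing F, ∀ B ∈ losing F, A ∪ B ∈ losing F

lemma infLetters_of_erasure {Γ : Type v} {w : ℕ → Option Γ} {u : ℕ → Γ} {φ : ℕ → ℕ}
    (hφ : StrictMono φ) (hr : Set.range φ = {n | w n ≠ none}) (hu : ∀ n, w (φ n) = some (u n)) :
    infLetters u = recurring w := by
  ext a
  have : {n | w n = some a} = φ '' {n | u n = a} := by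
    ext n
    constructor
    · intro h
      have h' : w n = some a := h
      have hn : n ∈ Set.range φ := by
        rw [hr]
        change w n ≠ none
        simp [h']
      obtain ⟨m, rfl⟩ := hn
      rw [hu] at h'
      exact ⟨m, Option.some_injective _ h', rfl⟩
    · rintro ⟨m, rfl, rfl⟩
      exact hu m
  change {n | u n = a}.Infinite ↔ {n | w n = some a}.Infinite
  rw [this, Set.infinite_image_iff hφ.injective.injOn]

lemma recurring_nonempty_iff {Γ : Type v} [Finite Γ] {w : ℕ → Option Γ} :
    (recurring w).Nonempty ↔ {n | w n ≠ none}.Infinite := by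
  constructor
  · rintro ⟨a, ha⟩
    refine Set.Infinite.mono (fun n hn => ?_) ha
    have hn' : w n = some a := hn
    change w n ≠ none
    simp [hn']
  · intro h
    by_contra hne
    refine h ?_
    have : {n | w n ≠ none} = ⋃ a, {n | w n = some a} := by
      ext n
      change w n ≠ none ↔ _
      simp [Option.ne_none_iff_exists']
    rw [this]
    refine Set.finite_iUnion fun a => ?_
    by_contra ha
    exact hne ⟨a, ha⟩

namespace Game

variable {Γ : Type v} {G : Game.{u, v} Γ}

lemma isWinningPlay_iff [Finite Γ] {F : Set (Set Γ)} (hG : G.win = mullerLanguage F)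
    {ρ : ℕ → G.edges} :
    G.IsWinningPlay ρ ↔ recurring (fun n => G.colour (ρ n)) ∉ losing F := by
  have key : recurring (fun n => G.colour (ρ n)) ∉ losing F ↔
      (recurring (fun n => G.colour (ρ n))).Nonempty ∧
        recurring (fun n => G.colour (ρ n)) ∈ F := by
    change ¬ (_ → _ ∉ F) ↔ _
    tauto
  rw [key]
  constructor
  · rintro ⟨u, ⟨φ, hφ, hr, hu⟩, hw⟩
    have hF : infLetters u ∈ F := by rwa [hG] at hw
    rw [infLetters_of_erasure hφ hr hu] at hF
    refine ⟨recurring_nonempty_iff.2 ?_, hF⟩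
    rw [← hr]
    exact Set.infinite_range_of_injective hφ.injective
  · rintro ⟨hne, hF⟩
    have hinf := recurring_nonempty_iff.1 hne
    have hr := Nat.range_nth_of_infinite hinf
    have hsome : ∀ n, ∃ a, G.colour (ρ (Nat.nth (fun n => G.colour (ρ n) ≠ none) n)) = some a :=
      fun n => Option.ne_none_iff_exists'.1 (Nat.nth_mem_of_infinite hinf n)
    choose u hu using hsome
    have hφ := Nat.nth_strictMono hinf
    refine ⟨u, ⟨_, hφ, hr, hu⟩, ?_⟩
    rw [hG]
    change infLetters u ∈ F
    rwa [infLetters_of_erasure hφ hr hu]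

lemma endFrom_append (x : G.V) (h : List G.edges) (e : G.edges) :
    G.endFrom x (h ++ [e]) = G.tgt e := by
  induction h generalizing x with
  | nil => rfl
  | cons a h ih => exact ih _

lemma last_append (h : List G.edges) (e : G.edges) : G.last (h ++ [e]) = G.tgt e :=
  endFrom_append _ h e

lemma isPathFrom_append {x : G.V} {h : List G.edges} {e : G.edges} :
    G.IsPathFrom x (h ++ [e]) ↔ G.IsPathFrom x h ∧ G.src e = G.endFrom x h := by
  induction h generalizing x with
  | nil => simp [IsPathFrom, endFrom]
  | cons a h ih => simp [IsPathFrom, endFrom, ih, and_assoc]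

lemma pre_succ (ρ : ℕ → G.edges) (n : ℕ) : G.pre ρ (n + 1) = G.pre ρ n ++ [ρ n] := by
  simp [pre, List.range_succ]

lemma last_pre {ρ : ℕ → G.edges} (h : G.IsPlay ρ) (n : ℕ) : G.last (G.pre ρ n) = G.src (ρ n) := by
  cases n with
  | zero => exact h.1.symm
  | succ n => rw [pre_succ, last_append, h.2]

/-- The partial plays in which Eve follows the strategy `σ`. -/
inductive Consistent (σ : List G.edges → G.edges) : List G.edges → Prop
  | nil : Consistent σ []
  | snoc {h : List G.edges} {e : G.edges} : Consistent σ h → G.src e = G.last h →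
      (G.last h ∈ G.eve → e = σ h) → Consistent σ (h ++ [e])

lemma Consistent.of_append {σ : List G.edges → G.edges} {h : List G.edges} {e : G.edges}
    (hc : Consistent σ (h ++ [e])) :
    Consistent σ h ∧ G.src e = G.last h ∧ (G.last h ∈ G.eve → e = σ h) := by
  generalize hk : h ++ [e] = k at hc
  cases hc with
  | nil => simp at hk
  | snoc h1 h2 h3 =>
    obtain ⟨rfl, h4⟩ := List.append_inj' hk rfl
    obtain rfl : e = _ := by simpa using h4
    exact ⟨h1, h2, h3⟩

lemma Consistent.isPartialPlay {σ : List G.edges → G.edges} {h : List G.edges}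
    (hc : Consistent σ h) : G.IsPartialPlay h := by
  induction hc with
  | nil => trivial
  | snoc _ h2 _ ih => exact isPathFrom_append.2 ⟨ih, h2⟩

/-- The tree of partial plays consistent with `σ`, labelled with the colours of the edges played. -/
def playTree (σ : List G.edges → G.edges) (h : List G.edges) (c : Option Γ)
    (k : List G.edges) : Prop :=
  Consistent σ k ∧ ∃ e, k = h ++ [e] ∧ G.colour e = c

/-- An infinite path of the tree of a winning strategy is a final part of a play that adheres to
the strategy. -/
lemma avoids_playTree [Finite Γ] {F : Set (Set Γ)} (hG : G.win = mullerLanguage F)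
    {σ : List G.edges → G.edges} (hσ : G.IsWinningStrategy σ) :
    Avoids (losing F) (playTree σ) := by
  intro x w hx
  have hx' : ∀ n, ∃ e, x (n + 1) = x n ++ [e] ∧ G.colour e = w n := fun n => (hx n).2
  choose e he hc using hx'
  let k := (x 0).length
  let ρ : ℕ → G.edges := fun m => if h : m < (x 0).length then (x 0)[m] else e (m - (x 0).length)
  have hpre : ∀ n, G.pre ρ (n + k) = x n := by
    intro n
    induction n with
    | zero =>
      refine List.ext_getElem (by simp [pre, k]) fun i h1 h2 => ?_
      simp [pre, ρ, h2]
    | succ n ih =>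
      rw [show n + 1 + k = n + k + 1 by omega, pre_succ, ih, he]
      simp [ρ, k]
  have hcons : ∀ m, Consistent σ (G.pre ρ m) := by
    have hdown : ∀ j m, Consistent σ (G.pre ρ (m + j)) → Consistent σ (G.pre ρ m) := by
      intro j
      induction j with
      | zero => exact fun m h => h
      | succ j ih =>
        intro m h
        rw [← add_assoc, pre_succ] at h
        exact ih m h.of_append.1
    intro m
    refine hdown (k + 1) m ?_
    rw [show m + (k + 1) = (m + 1) + k by omega, hpre]
    exact (hx m).1
  have hstep := fun m => (pre_succ ρ m ▸ hcons (m + 1)).of_append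
  have hplay : G.IsPlay ρ := by
    refine ⟨(hstep 0).2.1, fun n => ?_⟩
    rw [(hstep (n + 1)).2.1, pre_succ, last_append]
  have hwin := (isWinningPlay_iff hG).1 (hσ.2 ρ hplay fun n => (hstep n).2.2)
  rw [← recurring_shift _ k] at hwin
  convert hwin using 3 with n
  simp [ρ, k, hc]

/-- Eve chooses for each vertex a least partial play leading to it, among those consistent with a
given winning strategy, and moves as if it had been played. As the edges of the monotone extension
persist when sources are raised and targets lowered, her plays become runs of the extension. -/
lemma eveWinsWithMemory_one [Finite Γ] {F : Set (Set Γ)} (hF : LosingUnionClosed F)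
    (hG : G.win = mullerLanguage F) (hE : G.EveWins) : G.EveWinsWithMemory 1 := by
  classical
  obtain ⟨σ, hσ⟩ := hE
  obtain ⟨le, S, hle, hRS, -, hS, hmono⟩ := hasMonotoneExtension (L := losing F)
    (fun h => (Set.not_nonempty_empty h).elim) hF Set.univ (playTree σ)
    (fun _ _ _ _ => trivial) (avoids_playTree hG hσ)
  let X : G.V → Set (List G.edges) := fun x => {h | Consistent σ h ∧ G.last h = x}
  have hrep : ∀ x : G.V, ∃ h, (X x).Nonempty → h ∈ X x ∧ ∀ k ∈ X x, le h k := by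
    intro x
    by_cases hx : (X x).Nonempty
    · obtain ⟨m, hm⟩ := hle _ hx
      exact ⟨m, fun _ => hm⟩
    · exact ⟨[], fun h => (hx h).elim⟩
  choose r hr using hrep
  have hout : ∀ x : G.V, ∃ e : G.edges, G.src e = x := fun x => by
    obtain ⟨y, hy⟩ := G.exists_edge x
    exact ⟨⟨(x, y), hy⟩, rfl⟩
  choose out hout using hout
  let move : G.V → G.edges := fun x => if (X x).Nonempty then σ (r x) else out x
  have hmove : ∀ x ∈ G.eve, G.src (move x) = x := by
    intro x hx
    by_cases hX : (X x).Nonempty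
    · obtain ⟨⟨h1, h2⟩, -⟩ := hr x hX
      simp only [move, if_pos hX]
      rw [hσ.1 _ h1.isPartialPlay (h2.symm ▸ hx), h2]
    · simp only [move, if_neg hX, hout]
  refine ⟨Unit, inferInstance, ⟨(), fun _ _ => ()⟩, rfl, fun x _ => move x,
    fun x _ => hmove x x.2, fun h => move (G.last h), ⟨fun h _ hx => hmove _ hx, ?_⟩,
    fun _ _ _ => rfl⟩
  intro ρ hρ had
  let x : ℕ → G.V := fun n => G.last (G.pre ρ n)
  have hstep : ∀ n, (X (x n)).Nonempty → r (x n) ++ [ρ n] ∈ X (x (n + 1)) := by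
    intro n hn
    obtain ⟨⟨h1, h2⟩, -⟩ := hr _ hn
    refine ⟨h1.snoc ?_ fun hev => ?_, ?_⟩
    · rw [h2, ← last_pre hρ n]
    · rw [h2] at hev
      rw [had n hev]
      exact if_pos hn
    · rw [last_append]
      change _ = G.last (G.pre ρ (n + 1))
      rw [pre_succ, last_append]
  have hne : ∀ n, (X (x n)).Nonempty := by
    intro n
    induction n with
    | zero => exact ⟨[], Consistent.nil, rfl⟩
    | succ n ih => exact ⟨_, hstep n ih⟩
  rw [isWinningPlay_iff hG]
  refine hS (fun n => r (x n)) _ fun n => ?_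
  refine hmono _ (r (x n)) _ _ (r (x n) ++ [ρ n]) ?_ (hRS _ _ _ ⟨(hstep n (hne n)).1, _, rfl, rfl⟩)
    ((hr _ (hne (n + 1))).2 _ (hstep n (hne n)))
  exact (hr _ (hne n)).2 _ (hr _ (hne n)).1

end Game

/-! ### A game that needs memory -/

/-- The target of the edge leaving `x` in the game `twoLoops`, if the side `b` is chosen at the
base vertex. -/
def loopStep {n : ℕ} (x : Fin (n + 1) × Bool) (b : Bool) : Fin (n + 1) × Bool :=
  (x.1 + 1, if x.1 + 1 = 0 then true else if x.1 = 0 then b else x.2)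

/-- Two loops of length `n + 1` glued at one vertex, all vertices belonging to Eve. On side `b`, the
loop reads `f b 0, …, f b n`. The vertex `(i, b)` has position `i` on side `b`; the base vertex is
`(0, true)`, whereas `(0, false)` cannot be reached. -/
def twoLoops {Γ : Type v} (F : Set (Set Γ)) (n : ℕ) (f : Bool → Fin (n + 1) → Γ) :
    Game.{u, v} Γ where
  V := ULift.{u} (Fin (n + 1) × Bool)
  eve := Set.univ
  edges := {e | ∃ b, e.2.down = loopStep e.1.down b}
  init := ⟨(0, true)⟩
  colour e := some (f (if e.1.1.down.1 = 0 then e.1.2.down.2 else e.1.1.down.2) e.1.1.down.1)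
  win := mullerLanguage F
  exists_edge x := ⟨⟨loopStep x.down true⟩, true, rfl⟩
  no_eps_cycle x h := by
    cases h with
    | single h => exact absurd h.2 (by simp)
    | tail _ h => exact absurd h.2 (by simp)

section TwoLoops

variable {Γ : Type v} {F : Set (Set Γ)} {n : ℕ} {f : Bool → Fin (n + 1) → Γ}

/-- The side of the loop to which an edge belongs. -/
def side (e : (twoLoops.{u, v} F n f).edges) : Bool :=
  if e.1.1.down.1 = 0 then e.1.2.down.2 else e.1.1.down.2

variable {ρ : ℕ → (twoLoops.{u, v} F n f).edges}

lemma src_fst (hρ : (twoLoops.{u, v} F n f).IsPlay ρ) (t : ℕ) :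
    (ρ t).1.1.down.1 = Fin.ofNat (n + 1) t := by
  induction t with
  | zero => exact (congrArg (fun x => x.down.1) hρ.1).trans (by rfl)
  | succ t ih =>
    obtain ⟨b, hb⟩ := (ρ t).2
    have h : (ρ t).1.2 = (ρ (t + 1)).1.1 := hρ.2 t
    rw [← h, hb]
    change (ρ t).1.1.down.1 + 1 = _
    rw [ih]
    ext
    simp [Fin.val_add]

lemma src_of_base (hρ : (twoLoops.{u, v} F n f).IsPlay ρ) (q : ℕ) :
    (twoLoops.{u, v} F n f).src (ρ (q * (n + 1))) = ⟨(0, true)⟩ := by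
  rcases h : q * (n + 1) with _ | t
  · exact hρ.1
  · have h0 : (ρ (t + 1)).1.1.down.1 = 0 := by
      rw [src_fst hρ, ← h]
      ext
      simp
    rw [← hρ.2 t]
    have h1 : (ρ t).1.2 = (ρ (t + 1)).1.1 := hρ.2 t
    obtain ⟨b, hb⟩ := (ρ t).2
    rw [← h1, hb] at h0
    refine ULift.ext _ _ ?_
    change (ρ t).1.2.down = _
    rw [hb]
    refine Prod.ext h0 ?_
    exact if_pos h0

lemma side_eq (hρ : (twoLoops.{u, v} F n f).IsPlay ρ) (q i : ℕ) (hi : i < n + 1) :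
    side (ρ (q * (n + 1) + i)) = side (ρ (q * (n + 1))) := by
  induction i with
  | zero => rfl
  | succ i ih =>
    rw [← ih (by omega)]
    set t := q * (n + 1) + i with ht
    have h1 : (ρ t).1.2 = (ρ (t + 1)).1.1 := hρ.2 t
    have h2 : (ρ (t + 1)).1.1.down.1 ≠ 0 := by
      rw [src_fst hρ]
      intro h
      have h' := congrArg Fin.val h
      have h3 : t + 1 = i + 1 + (n + 1) * q := by rw [ht]; ring
      simp only [Fin.val_ofNat, Fin.val_zero, h3, Nat.add_mul_mod_self_left] at h'
      rw [Nat.mod_eq_of_lt hi] at h'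
      omega
    have h3 : side (ρ (t + 1)) = (ρ t).1.2.down.2 := by
      rw [side, if_neg h2, h1]
    change side (ρ (t + 1)) = _
    rw [h3, side]
    split_ifs with h0
    · rfl
    · obtain ⟨b, hb⟩ := (ρ t).2
      rw [← h1, hb] at h2
      rw [hb]
      exact (if_neg h2).trans (if_neg h0)

lemma colour_eq (hρ : (twoLoops.{u, v} F n f).IsPlay ρ) (q : ℕ) (i : Fin (n + 1)) :
    (twoLoops.{u, v} F n f).colour (ρ (q * (n + 1) + i)) =
      some (f (side (ρ (q * (n + 1)))) i) := by
  rw [← side_eq hρ q i i.2]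
  change some (f (side _) _) = _
  rw [src_fst hρ]
  congr 2
  ext
  simp [Nat.mod_eq_of_lt i.2]

lemma range_subset_recurring (hρ : (twoLoops.{u, v} F n f).IsPlay ρ) {b : Bool}
    (hb : {q | side (ρ (q * (n + 1))) = b}.Infinite) :
    Set.range (f b) ⊆ recurring fun t => (twoLoops.{u, v} F n f).colour (ρ t) := by
  rintro _ ⟨i, rfl⟩
  have hinj : Function.Injective fun q : ℕ => q * (n + 1) + (i : ℕ) := fun q q' h =>
    Nat.eq_of_mul_eq_mul_right (Nat.succ_pos n) (Nat.add_right_cancel h)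
  refine (hb.image hinj.injOn).mono ?_
  rintro _ ⟨q, rfl, rfl⟩
  exact colour_eq hρ q i

lemma recurring_subset_range (hρ : (twoLoops.{u, v} F n f).IsPlay ρ) {A : Set Γ}
    (hA : ∀ q, Set.range (f (side (ρ (q * (n + 1))))) ⊆ A) :
    (recurring fun t => (twoLoops.{u, v} F n f).colour (ρ t)) ⊆ A := by
  intro a ha
  obtain ⟨t, ht⟩ := Set.Infinite.nonempty ha
  have h := colour_eq hρ (t / (n + 1)) ⟨t % (n + 1), Nat.mod_lt _ (Nat.succ_pos n)⟩
  simp only [Nat.div_add_mod'] at h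
  have ht' : (twoLoops.{u, v} F n f).colour (ρ t) = some a := ht
  rw [ht'] at h
  exact hA _ ⟨_, (Option.some_injective _ h).symm⟩

/-- Eve wins if the union of the colours of both loops is not losing: she alternates. -/
lemma eveWins_twoLoops [Finite Γ] (hn : n ≠ 0)
    (hf : Set.range (f true) ∪ Set.range (f false) ∉ losing F) :
    (twoLoops.{u, v} F n f).EveWins := by
  let G := twoLoops.{u, v} F n f
  let σ : List G.edges → G.edges := fun h =>
    ⟨(G.last h, ⟨loopStep (G.last h).down (h.length / (n + 1)).bodd⟩), _, rfl⟩
  refine ⟨σ, fun _ _ _ => rfl, fun ρ hρ had => ?_⟩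
  rw [Game.isWinningPlay_iff (F := F) rfl]
  have hside : ∀ q, side (ρ (q * (n + 1))) = q.bodd := by
    intro q
    have h1 : ρ (q * (n + 1)) = σ (G.pre ρ (q * (n + 1))) := had _ trivial
    have h2 : G.last (G.pre ρ (q * (n + 1))) = ⟨(0, true)⟩ := by
      rw [Game.last_pre hρ]
      exact src_of_base hρ q
    have hlen : (G.pre ρ (q * (n + 1))).length / (n + 1) = q := by simp [Game.pre]
    rw [h1]
    simp only [side, σ, hlen]
    rw [h2]
    simp [loopStep, hn]
  have hinf : ∀ b, {q | side (ρ (q * (n + 1))) = b}.Infinite := by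
    intro b
    refine Set.infinite_of_injective_forall_mem (f := fun q => Nat.bit b q) ?_ ?_
    · intro q q' h
      simpa using congrArg Nat.div2 h
    · intro q
      change side _ = b
      rw [hside, Nat.bodd_bit]
  have : (recurring fun t => G.colour (ρ t)) = Set.range (f true) ∪ Set.range (f false) := by
    refine Set.Subset.antisymm (recurring_subset_range hρ fun q => ?_)
      (Set.union_subset (range_subset_recurring hρ (hinf _)) (range_subset_recurring hρ (hinf _)))
    cases side (ρ (q * (n + 1)))
    · exact Set.subset_union_right
    · exact Set.subset_union_left
  change (recurring fun t => G.colour (ρ t)) ∉ _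
  rwa [this]

/-- Without memory, Eve stays on one side forever. -/
lemma exists_range_notMem_losing [Finite Γ]
    (h : (twoLoops.{u, v} F n f).EveWinsWithMemory 1) : ∃ b, Set.range (f b) ∉ losing F := by
  let G := twoLoops.{u, v} F n f
  obtain ⟨M, _, μ, hM, next, hnext, σ, ⟨hσ, hwin⟩, hσn⟩ := h
  have hsub : Subsingleton M := Fintype.card_le_one_iff_subsingleton.1 hM.le
  let hist : ℕ → List G.edges := fun t => (fun h => h ++ [σ h])^[t] []
  have hhist : ∀ t, hist (t + 1) = hist t ++ [σ (hist t)] := fun t =>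
    Function.iterate_succ_apply' _ _ _
  let ρ : ℕ → G.edges := fun t => σ (hist t)
  have hpre : ∀ t, G.pre ρ t = hist t := by
    intro t
    induction t with
    | zero => rfl
    | succ t ih => rw [Game.pre_succ, ih, hhist]
  have hpp : ∀ t, G.IsPartialPlay (hist t) := by
    intro t
    induction t with
    | zero => trivial
    | succ t ih =>
      rw [hhist]
      exact Game.isPathFrom_append.2 ⟨ih, hσ _ ih trivial⟩
  have hρ : G.IsPlay ρ := by
    refine ⟨hσ _ (hpp 0) trivial, fun t => ?_⟩
    have h1 : G.src (ρ (t + 1)) = G.last (hist (t + 1)) := hσ _ (hpp (t + 1)) trivial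
    rw [h1, hhist, Game.last_append]
  have had : G.Adheres σ ρ := fun t _ => by rw [hpre]
  have hmove : ∀ q, ρ (q * (n + 1)) = next ⟨⟨(0, true)⟩, trivial⟩ μ.start := by
    intro q
    have h1 : G.last (hist (q * (n + 1))) = ⟨(0, true)⟩ := by
      rw [← hpre, Game.last_pre hρ]
      exact src_of_base hρ q
    refine (hσn _ (hpp _) trivial).trans ?_
    rw [Subsingleton.elim (μ.state _) μ.start]
    congr 1
    exact Subtype.ext h1
  let b := side (next ⟨⟨(0, true)⟩, trivial⟩ μ.start)
  have hside : ∀ q, side (ρ (q * (n + 1))) = b := fun q => congrArg side (hmove q)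
  refine ⟨b, ?_⟩
  have hwin' := (Game.isWinningPlay_iff (F := F) rfl).1 (hwin ρ hρ had)
  have hrec : (recurring fun t => G.colour (ρ t)) = Set.range (f b) := by
    refine Set.Subset.antisymm (recurring_subset_range hρ fun q => ?_)
      (range_subset_recurring hρ ?_)
    · rw [hside]
    · simp only [hside]
      exact Set.infinite_univ
  rwa [hrec] at hwin'

end TwoLoops

lemma losingUnionClosed_of_halfPositionallyDetermined {Γ : Type v} [Finite Γ] {F : Set (Set Γ)}
    (h : HalfPositionallyDetermined (epsFreeGames.{u, v} F ∩ finiteGames Γ)) :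
    LosingUnionClosed F := by
  intro A hA B hB
  rcases A.eq_empty_or_nonempty with rfl | hAn
  · rwa [Set.empty_union]
  rcases B.eq_empty_or_nonempty with rfl | hBn
  · rwa [Set.union_empty]
  by_contra hAB
  obtain ⟨n, ⟨e⟩⟩ := Finite.exists_equiv_fin Γ
  have hn : n ≠ 0 := by
    rintro rfl
    exact (e hAn.some).elim0
  have hsurj : ∀ X : Set Γ, X.Nonempty → ∃ g : Fin (n + 1) → Γ, Set.range g = X := by
    intro X hX
    have : Nonempty X := hX.to_subtype
    have hinj : Function.Injective fun x : X => (e x).castSucc :=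
      (Fin.castSucc_injective n).comp (e.injective.comp Subtype.val_injective)
    refine ⟨fun i => (Function.invFun (fun x : X => (e x).castSucc) i : X), ?_⟩
    rw [Set.range_comp' Subtype.val, (Function.invFun_surjective hinj).range_eq, Set.image_univ,
      Subtype.range_val]
  obtain ⟨g, hg⟩ := hsurj A hAn
  obtain ⟨k, hk⟩ := hsurj B hBn
  let f : Bool → Fin (n + 1) → Γ := fun b => if b then g else k
  have hf1 : Set.range (f true) = A := hg
  have hf2 : Set.range (f false) = B := hk
  have hfin : Finite (twoLoops.{u, v} F n f).V :=
    inferInstanceAs (Finite (ULift.{u} (Fin (n + 1) × Bool)))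
  obtain ⟨b, hb⟩ := exists_range_notMem_losing (h (twoLoops.{u, v} F n f)
    ⟨⟨rfl, fun _ => Option.some_ne_none _⟩, hfin⟩
    (eveWins_twoLoops hn (by rwa [hf1, hf2])))
  cases b
  · exact hb (hf2 ▸ hB)
  · exact hb (hf1 ▸ hA)

/-! ### The equivalences -/

lemma HalfPositionallyDetermined.mono {Γ : Type v} {𝒢 ℋ : Set (Game.{u, v} Γ)} (h : 𝒢 ⊆ ℋ)
    (hd : HalfPositionallyDetermined ℋ) : HalfPositionallyDetermined 𝒢 :=
  fun G hG => hd G (h hG)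

lemma memGen_eq_one_iff {Γ : Type v} (𝒢 : Set (Game.{u, v} Γ)) :
    memGen 𝒢 = 1 ↔ HalfPositionallyDetermined 𝒢 := by
  constructor
  · intro h
    have hne : {k : ℕ∞ | ∃ n : ℕ, k = n ∧ 1 ≤ n ∧
        ∀ G ∈ 𝒢, G.EveWins → G.EveWinsWithMemory n}.Nonempty := by
      rw [Set.nonempty_iff_ne_empty]
      intro he
      rw [memGen, he, sInf_empty] at h
      exact absurd h (by decide)
    obtain ⟨n, hn, -, hG⟩ := csInf_mem hne
    have h1 : (1 : ℕ∞) = n := h.symm.trans hn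
    obtain rfl : 1 = n := by exact_mod_cast h1
    exact hG
  · intro h
    refine le_antisymm (sInf_le ⟨1, rfl, le_rfl, h⟩) (le_sInf ?_)
    rintro _ ⟨n, rfl, hn, -⟩
    exact_mod_cast hn

/-- Every family between the finite `ε`-free `F`-games and all `F`-games is half-positionally
determined exactly if the losing sets are closed under unions. -/
theorem halfPositionallyDetermined_iff {Γ : Type v} [Finite Γ] {F : Set (Set Γ)}
    {𝒢 : Set (Game.{u, v} Γ)} (h1 : epsFreeGames F ∩ finiteGames Γ ⊆ 𝒢) (h2 : 𝒢 ⊆ games F) :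
    HalfPositionallyDetermined 𝒢 ↔ LosingUnionClosed F :=
  ⟨fun h => losingUnionClosed_of_halfPositionallyDetermined (h.mono h1),
    fun h _ hG => Game.eveWinsWithMemory_one h (h2 hG)⟩

end MullerGames

theorem lemma3p4 {Γ : Type v} [Finite Γ] (F : Set (Set Γ)) :
    ((MullerGames.HalfPositionallyDetermined (MullerGames.epsFreeGames.{u, v} F) ↔
        MullerGames.HalfPositionallyDetermined (MullerGames.games.{u, v} F)) ∧
      (MullerGames.memGen (MullerGames.games.{u, v} F) = 1 ↔
        MullerGames.memGen (MullerGames.epsFreeGames.{u, v} F) = 1)) ∧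
    ((MullerGames.HalfPositionallyDetermined
          (MullerGames.epsFreeGames.{u, v} F ∩ MullerGames.finiteGames Γ) ↔
        MullerGames.HalfPositionallyDetermined
          (MullerGames.games.{u, v} F ∩ MullerGames.finiteGames Γ)) ∧
      (MullerGames.memGen (MullerGames.games.{u, v} F ∩ MullerGames.finiteGames Γ) = 1 ↔
        MullerGames.memGen
          (MullerGames.epsFreeGames.{u, v} F ∩ MullerGames.finiteGames Γ) = 1)) := by
  open MullerGames in
  simp only [memGen_eq_one_iff]
  have hef : epsFreeGames.{u, v} F ⊆ games F := fun _ h => h.1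
  have e1 := halfPositionallyDetermined_iff (F := F) Set.inter_subset_left hef
  have e2 := halfPositionallyDetermined_iff (F := F) (Set.inter_subset_left.trans hef) subset_rfl
  have e3 := halfPositionallyDetermined_iff (F := F) subset_rfl (Set.inter_subset_left.trans hef)
  have e4 := halfPositionallyDetermined_iff (F := F)
    (Set.inter_subset_inter_left (finiteGames Γ) hef) Set.inter_subset_left
  rw [e1, e2, e3, e4]
  simp only [iff_self, and_self]
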